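/- Let $\Omega\subset\mathbb R^n$ be a nonempty bounded open set, let $K\in C(\mathbb R^n\times\mathbb R^n)$, $K\ge 0$, be such that for some $c_0,\epsilon_0>0$ one has $K(x,y)>c_0$ whenever $x\in\Omega$ and $|x-y|<\epsilon_0$, and let $a\in C(\overline\Omega)$. Put $A:=\sup_\Omega a$ and $\Omega_0:=\{y\in\overline\Omega : a(y)=A\}$. Define $$\lambda_p:=\sup\Big\{\lambda\in\mathbb R : \exists\,\varphi\in C(\Omega),\ \varphi>0,\ \int_\Omega K(x,y)\varphi(y)\,dy+a(x)\varphi(x)+\lambda\varphi(x)\le 0\ \text{ for all }x\in\Omega\Big\},$$ where the inequality includes that the integral is finite. Assume that $$\int_\Omega\frac{dx}{A-a(x)}<\infty\quad(\text{with } 1/0=+\infty)\qquad\text{and}\qquad \lambda_p=-A .$$ A *positive measure solution* is a nonzero finite positive Borel measure $\mu$ on $\overline\Omega$ such that $$\int_{\overline\Omega} K(x,y)\,d\mu(y)+(a(x)+\lambda_p)\,\mu=0,$$ as an equality of signed measures on $\overline\Omega$, where the first term denotes the measure with this density with respect to Lebesgue measure on $\Omega$; that is, for all Borel sets $B\subset\overline\Omega$,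 $$\int_{B\cap\Omega}\Big(\int_{\overline\Omega} K(x,y)\,d\mu(y)\Big)dx+\int_B (a+\lambda_p)\,d\mu=0 .$$ 1. There exists a positive measure solution. More precisely, for every $x_0\in\Omega_0$ there are $\alpha\ge 0$ and $g\in C(\overline\Omega)$, $g\ge 0$, such that $\mu=\alpha\,\delta_{x_0}+\dfrac{g(x)}{A-a(x)}\,dx|_{\Omega}$ is a positive measure solution. 2. If there is a positive measure solution that is not absolutely continuous with respect to Lebesgue measure, and $\Omega_0$ has more than one point, then there are infinitely many positive measure solutions of total mass one (hence infinitely many that are pairwise non-proportional). -/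

import Mathlib

open MeasureTheory Set

namespace NonlocalOperator

noncomputable section

/-- The supremum of `a` over the set `Ω`. -/
def supOn {n : ℕ} (a : EuclideanSpace ℝ (Fin n) → ℝ) (Ω : Set (EuclideanSpace ℝ (Fin n))) : ℝ :=
  sSup (a '' Ω)

/-- The set of points of the closure of `Ω` at which `a` equals its supremum over `Ω`. -/
def maxSet {n : ℕ} (a : EuclideanSpace ℝ (Fin n) → ℝ) (Ω : Set (EuclideanSpace ℝ (Fin n))) :
    Set (EuclideanSpace ℝ (Fin n)) :=
  {y | y ∈ closure Ω ∧ a y = supOn a Ω}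

/-- The generalised principal eigenvalue of `φ ↦ ∫_Ω K(·,y) φ(y) dy + a φ`: the supremum of the
`lam` that admit a positive `φ ∈ C(Ω)` with `∫_Ω K(x,y) φ(y) dy + a(x) φ(x) + lam φ(x) ≤ 0` on `Ω`.
The integrability clause says that the (nonnegative) integral is finite, which the inequality
presupposes. -/
def principalEigenvalue {n : ℕ}
    (K : EuclideanSpace ℝ (Fin n) → EuclideanSpace ℝ (Fin n) → ℝ)
    (a : EuclideanSpace ℝ (Fin n) → ℝ) (Ω : Set (EuclideanSpace ℝ (Fin n))) : ℝ :=
  sSup {lam : ℝ | ∃ φ : EuclideanSpace ℝ (Fin n) → ℝ,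
    ContinuousOn φ Ω ∧ (∀ x ∈ Ω, 0 < φ x) ∧
    ∀ x ∈ Ω, IntegrableOn (fun y => K x y * φ y) Ω ∧
      (∫ y in Ω, K x y * φ y) + a x * φ x + lam * φ x ≤ 0}

/-- `μ` is a nonzero finite positive Borel measure on the closure of `Ω` (a measure on `ℝⁿ` giving
no mass to the complement) and solves `∫ K(x,y) dμ(y) + (a(x) + lam) μ = 0`. The equation is an
equality of signed Borel measures on the closure of `Ω`, in which the function
`x ↦ ∫ K(x,y) dμ(y)` on `Ω` stands for the measure with this density with respect to Lebesgue
measure on `Ω`. -/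
structure IsPositiveMeasureSolution {n : ℕ}
    (K : EuclideanSpace ℝ (Fin n) → EuclideanSpace ℝ (Fin n) → ℝ)
    (a : EuclideanSpace ℝ (Fin n) → ℝ) (Ω : Set (EuclideanSpace ℝ (Fin n))) (lam : ℝ)
    (μ : Measure (EuclideanSpace ℝ (Fin n))) : Prop where
  finite : IsFiniteMeasure μ
  concentrated : μ (closure Ω)ᶜ = 0
  ne_zero : μ ≠ 0
  equation : ∀ B : Set (EuclideanSpace ℝ (Fin n)), MeasurableSet B →
    (∫ x in B ∩ Ω, (∫ y in closure Ω, K x y ∂μ)) + (∫ x in B ∩ closure Ω, (a x + lam) ∂μ) = 0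

/-- The measure `α δ_{x₀} + g(x) / (sup_Ω a - a(x)) dx`, with `dx` Lebesgue measure on `Ω`. -/
def diracPlusDensity {n : ℕ} (a : EuclideanSpace ℝ (Fin n) → ℝ)
    (Ω : Set (EuclideanSpace ℝ (Fin n))) (α : ℝ) (x₀ : EuclideanSpace ℝ (Fin n))
    (g : EuclideanSpace ℝ (Fin n) → ℝ) : Measure (EuclideanSpace ℝ (Fin n)) :=
  ENNReal.ofReal α • Measure.dirac x₀ +
    (volume.restrict Ω).withDensity (fun x => ENNReal.ofReal (g x / (supOn a Ω - a x)))

end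

end NonlocalOperator

/-! Write `b = A - a` and `T f = ∫ K(·,y) f(y) / b(y) dy` over `Ω`. Since `a + λ_p = -b` vanishes at
a maximum point `x₀`, the measure `s δ_{x₀} + (g / b) dx` solves the equation once `g = T g + s
K(·,x₀)` on the closure, because its potential `∫ K(·,y) dμ(y)` is then `g`. It remains to find `s,
g ≥ 0`, not both zero.

Replace `b` by `b + ε`. As `λ_p = -A`, some `φ > 0` satisfies `∫ K φ ≤ (b + ε) φ`, and `ψ = ∫ K φ`
is a supersolution of the regularised operator, continuous and positive on the closure
(`exists_supersolution`). Enlarging `ε` makes it strict, so a Neumann series solves the regularised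
equation with source `K(·,x₀)` (`exists_nonneg_eq_kernelOperator_add`). After normalisation,
integrability of `1 / b` gives equicontinuity and dominated convergence as `ε → 0`
(`exists_eq_kernelOperator_inv_add`).

If there are only finitely many solutions of mass one, all solutions are proportional, since two
different normalised ones span a segment of solutions. The solution built at `x` is then
proportional to the one built at another maximum point `y`, which does not charge `x`. So it has no
atom and is absolutely continuous, and hence so is every solution. -/

namespace NonlocalOperator

open Filter Topology

/-! ### Positive integral operators on a compact space -/

section KernelOperator

variable {X : Type*} [TopologicalSpace X] [CompactSpace X] [MeasurableSpace X] [BorelSpace X]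

theorem integrable_kernel_mul {m : Measure X} {w : X → ℝ} (hw : Integrable w m)
    (k f : C(X, ℝ)) : Integrable (fun y => k y * f y * w y) m := by
  refine hw.bdd_mul (c := ‖k * f‖) (k * f).continuous.aestronglyMeasurable ?_
  exact Eventually.of_forall fun y => (k * f).norm_coe_le_norm y

theorem norm_integral_kernel_mul_le {m : Measure X} {w : X → ℝ} (hw : Integrable w m)
    (k f : C(X, ℝ)) : ‖∫ y, k y * f y * w y ∂m‖ ≤ ‖k‖ * ‖f‖ * ∫ y, ‖w y‖ ∂m := by
  rw [← integral_const_mul]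
  refine norm_integral_le_of_norm_le (hw.norm.const_mul _)
    (Eventually.of_forall fun y => ?_)
  rw [norm_mul, norm_mul]
  gcongr
  · exact k.norm_coe_le_norm y
  · exact f.norm_coe_le_norm y

/-- The integral operator `f ↦ ∫ k(·,y) f(y) w(y) dm(y)` on continuous functions on a compact
space, for a continuous kernel and an integrable weight. The kernel is given in curried form. -/
noncomputable def kernelOperator (m : Measure X) (k : C(X, C(X, ℝ))) (w : X → ℝ)
    (hw : Integrable w m) : C(X, ℝ) →L[ℝ] C(X, ℝ) :=
  LinearMap.mkContinuous
    { toFun := fun f => ⟨fun x => ∫ y, k x y * f y * w y ∂m, by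
        have hlip : ∀ x x' : X, dist (∫ y, k x y * f y * w y ∂m) (∫ y, k x' y * f y * w y ∂m)
            ≤ dist (k x) (k x') * (‖f‖ * ∫ y, ‖w y‖ ∂m) := by
          intro x x'
          rw [dist_eq_norm, dist_eq_norm, ← integral_sub (integrable_kernel_mul hw _ _)
            (integrable_kernel_mul hw _ _), ← mul_assoc]
          refine le_trans (le_of_eq ?_) (norm_integral_kernel_mul_le hw (k x - k x') f)
          congr 2
          ext y
          simp only [ContinuousMap.sub_apply]
          ring
        refine continuous_iff_continuousAt.2 fun x => tendsto_iff_dist_tendsto_zero.2 ?_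
        refine squeeze_zero (fun _ => dist_nonneg) (fun x' => hlip x' x) ?_
        have h := (tendsto_iff_dist_tendsto_zero.1 (k.continuous.tendsto x)).mul_const
          (‖f‖ * ∫ y, ‖w y‖ ∂m)
        simpa using h⟩
      map_add' := fun f g => by
        ext x
        simp only [ContinuousMap.coe_mk, ContinuousMap.add_apply]
        rw [← integral_add (integrable_kernel_mul hw _ _) (integrable_kernel_mul hw _ _)]
        congr 1
        ext y
        ring
      map_smul' := fun c f => by
        ext x
        simp only [ContinuousMap.coe_mk, ContinuousMap.smul_apply, smul_eq_mul, RingHom.id_apply]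
        rw [← integral_const_mul]
        congr 1
        ext y
        ring }
    (‖k‖ * ∫ y, ‖w y‖ ∂m) (fun f => by
      have hI : 0 ≤ ∫ y, ‖w y‖ ∂m := integral_nonneg fun y => norm_nonneg _
      refine (ContinuousMap.norm_le _ (by positivity)).2 fun x => ?_
      refine (norm_integral_kernel_mul_le hw (k x) f).trans ?_
      have := k.norm_coe_le_norm x
      calc ‖k x‖ * ‖f‖ * ∫ y, ‖w y‖ ∂m ≤ ‖k‖ * ‖f‖ * ∫ y, ‖w y‖ ∂m := by gcongr
        _ = _ := by ring)

variable {m : Measure X} {k : C(X, C(X, ℝ))} {w : X → ℝ}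

theorem kernelOperator_apply (hw : Integrable w m) (f : C(X, ℝ)) (x : X) :
    kernelOperator m k w hw f x = ∫ y, k x y * f y * w y ∂m := rfl

theorem kernelOperator_mono (hw : Integrable w m) (hw0 : 0 ≤ᵐ[m] w) (hk : ∀ x y, 0 ≤ k x y)
    {f g : C(X, ℝ)} (hfg : f ≤ g) : kernelOperator m k w hw f ≤ kernelOperator m k w hw g := by
  intro x
  refine integral_mono_ae (integrable_kernel_mul hw _ _) (integrable_kernel_mul hw _ _) ?_
  filter_upwards [hw0] with y hy
  exact mul_le_mul_of_nonneg_right (mul_le_mul_of_nonneg_left (hfg y) (hk x y)) hy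

/-- A positive strict supersolution of a positive integral operator makes the inhomogeneous
equation solvable in the nonnegative continuous functions. -/
theorem exists_nonneg_eq_kernelOperator_add (hw : Integrable w m) (hw0 : 0 ≤ᵐ[m] w)
    (hk : ∀ x y, 0 ≤ k x y) {ψ : C(X, ℝ)} (hψ : ∀ x, 0 < ψ x) {θ : ℝ} (hθ0 : 0 ≤ θ) (hθ : θ < 1)
    (hsup : kernelOperator m k w hw ψ ≤ θ • ψ) {h : C(X, ℝ)} (hh : 0 ≤ h) :
    ∃ g : C(X, ℝ), 0 ≤ g ∧ g = kernelOperator m k w hw g + h := by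
  set T := kernelOperator m k w hw with hT
  have hmono : ∀ {f g : C(X, ℝ)}, f ≤ g → T f ≤ T g := kernelOperator_mono hw hw0 hk
  obtain ⟨C, hC0, hC⟩ : ∃ C : ℝ, 0 ≤ C ∧ h ≤ C • ψ := by
    have hcont : Continuous fun x => h x / ψ x :=
      h.continuous.div ψ.continuous fun x => (hψ x).ne'
    obtain ⟨C, hC⟩ := (isCompact_range hcont).bddAbove
    refine ⟨max C 0, le_max_right _ _, fun x => ?_⟩
    have h1 : h x / ψ x ≤ max C 0 := (hC (mem_range_self x)).trans (le_max_left _ _)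
    exact (div_le_iff₀ (hψ x)).1 h1
  -- The operator norm of `T` may exceed one; decay of the iterates comes from comparison with `ψ`,
  -- as monotonicity propagates `T ψ ≤ θ ψ`.
  have hpow : ∀ j : ℕ, 0 ≤ (T ^ j) h ∧ (T ^ j) h ≤ (C * θ ^ j) • ψ := by
    intro j
    induction j with
    | zero => simpa using ⟨hh, hC⟩
    | succ j ih =>
      rw [pow_succ']
      constructor
      · simpa using hmono ih.1
      · refine (hmono ih.2).trans ?_
        rw [map_smul]
        intro x
        have h1 : T ψ x ≤ θ * ψ x := hsup x
        have h2 : 0 ≤ C * θ ^ j := by positivity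
        have := mul_le_mul_of_nonneg_left h1 h2
        change C * θ ^ j * T ψ x ≤ C * θ ^ (j + 1) * ψ x
        rw [pow_succ]
        linarith
  have hsum : Summable fun j : ℕ => (T ^ j) h := by
    refine Summable.of_norm_bounded (g := fun j => C * ‖ψ‖ * θ ^ j)
      ((summable_geometric_of_lt_one hθ0 hθ).mul_left _) fun j => ?_
    refine (ContinuousMap.norm_le _ (by positivity)).2 fun x => ?_
    have h0 : 0 ≤ (T ^ j) h x := (hpow j).1 x
    rw [Real.norm_of_nonneg h0]
    have h1 : (T ^ j) h x ≤ C * θ ^ j * ψ x := (hpow j).2 x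
    have h2 : ψ x ≤ ‖ψ‖ := (le_abs_self _).trans (ψ.norm_coe_le_norm x)
    have h3 : 0 ≤ C * θ ^ j := by positivity
    nlinarith [mul_le_mul_of_nonneg_left h2 h3]
  refine ⟨∑' j, (T ^ j) h, ?_, ?_⟩
  · intro x
    change 0 ≤ (∑' j, (T ^ j) h) x
    rw [← ContinuousMap.tsum_apply hsum x]
    exact tsum_nonneg fun j => (hpow j).1 x
  · rw [T.map_tsum hsum, hsum.tsum_eq_zero_add, add_comm]
    simp [pow_succ']

end KernelOperator

/-! ### The integral equation with the singular weight `1 / b` -/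

section Limit

theorem integrable_inv_of_lintegral_inv_lt_top {α : Type*} {mα : MeasurableSpace α} {m : Measure α}
    {b : α → ℝ} (hb : AEStronglyMeasurable b m)
    (hb0 : ∀ᵐ x ∂m, 0 ≤ b x) (hint : ∫⁻ x, (ENNReal.ofReal (b x))⁻¹ ∂m < ⊤) :
    (∀ᵐ x ∂m, 0 < b x) ∧ Integrable (fun x => (b x)⁻¹) m := by
  have hae : ∀ᵐ x ∂m, 0 < b x := by
    filter_upwards [ae_lt_top' hb.aemeasurable.ennreal_ofReal.inv hint.ne] with x hx
    simpa [ENNReal.inv_lt_top] using hx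
  refine ⟨hae, hb.aemeasurable.inv.aestronglyMeasurable, ?_⟩
  rw [hasFiniteIntegral_iff_ofReal (hb0.mono fun x hx => inv_nonneg.2 hx)]
  refine lt_of_le_of_lt (lintegral_mono_ae ?_) hint
  filter_upwards [hae] with x hx
  rw [ENNReal.ofReal_inv_of_pos hx]

variable {X : Type*} [MetricSpace X] [CompactSpace X] [MeasurableSpace X] [BorelSpace X]
  {m : Measure X} {k : C(X, C(X, ℝ))}

/-- Arzelà–Ascoli: the modulus of continuity does not depend on `j` and tends to zero as `x' → x`,
because `k` and `h` are continuous. -/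
theorem exists_tendsto_subseq_of_dist_le {W : ℝ} {h : C(X, ℝ)} {f : ℕ → C(X, ℝ)}
    (hbdd : ∀ j, ‖f j‖ ≤ 1)
    (hlip : ∀ j x x', dist (f j x) (f j x') ≤ dist (k x) (k x') * W + dist (h x) (h x')) :
    ∃ F : C(X, ℝ), ∃ φ : ℕ → ℕ, StrictMono φ ∧ Tendsto (f ∘ φ) atTop (𝓝 F) := by
  set A : Set C(X, ℝ) := {g | (∀ x, g x ∈ Icc (-1 : ℝ) 1) ∧
    ∀ x x', dist (g x) (g x') ≤ dist (k x) (k x') * W + dist (h x) (h x')} with hA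
  have hequi : Equicontinuous ((↑) : A → X → ℝ) := by
    intro x₀
    refine Metric.equicontinuousAt_of_continuity_modulus
      (fun x => dist (k x₀) (k x) * W + dist (h x₀) (h x)) ?_ _
      (Eventually.of_forall fun x g => g.2.2 x₀ x)
    have hc : Continuous fun x => dist (k x₀) (k x) * W + dist (h x₀) (h x) := by fun_prop
    simpa using hc.tendsto x₀
  have hcomp : IsCompact A := by
    refine ArzelaAscoli.isCompact_of_equicontinuous A ?_ hequi
    -- The modulus already forces continuity, so the image is cut out of a product of compact
    -- intervals by conditions closed under pointwise convergence.
    have himg : ContinuousMap.toFun '' A = {g : X → ℝ | (∀ x, g x ∈ Icc (-1 : ℝ) 1) ∧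
        ∀ x x', dist (g x) (g x') ≤ dist (k x) (k x') * W + dist (h x) (h x')} := by
      ext g
      constructor
      · rintro ⟨u, hu, rfl⟩
        exact hu
      · intro hg
        refine ⟨⟨g, continuous_iff_continuousAt.2 fun x => tendsto_iff_dist_tendsto_zero.2 ?_⟩,
          hg, rfl⟩
        refine squeeze_zero (fun _ => dist_nonneg) (fun x' => hg.2 x' x) ?_
        have hc : Continuous fun x' => dist (k x') (k x) * W + dist (h x') (h x) := by fun_prop
        simpa using hc.tendsto x
    rw [himg, ofPred_and]
    refine IsCompact.inter_right ?_ ?_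
    · simpa [Set.pi] using isCompact_univ_pi (fun _ : X => isCompact_Icc (a := (-1 : ℝ)) (b := 1))
    · simp only [ofPred_forall]
      exact isClosed_iInter fun x => isClosed_iInter fun x' =>
        isClosed_le ((continuous_apply x).dist (continuous_apply x')) continuous_const
  have hmem : ∀ j, f j ∈ A := fun j =>
    ⟨fun x => abs_le.1 (((f j).norm_coe_le_norm x).trans (hbdd j)), hlip j⟩
  obtain ⟨F, -, φ, hφ, hF⟩ := hcomp.tendsto_subseq hmem
  exact ⟨F, φ, hφ, hF⟩

/-- The solutions with weight `(b + ε)⁻¹` and source `h` may blow up as `ε → 0`. Scaling solution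
and source strength together to `s + ‖f‖ = 1` keeps a nonzero limit; `s = 0` is the case of blow-up.
-/
theorem exists_eq_kernelOperator_inv_add (hk : ∀ x y, 0 ≤ k x y) {b : C(X, ℝ)} (hb0 : ∀ x, 0 ≤ b x) (hbae : ∀ᵐ x ∂m, 0 < b x)
    (hint : Integrable (fun x => (b x)⁻¹) m)
    (hsup : ∀ ε > 0, ∃ ψ : C(X, ℝ), (∀ x, 0 < ψ x) ∧
      ∀ x, ∫ y, k x y * ψ y * (b y + ε)⁻¹ ∂m ≤ ψ x)
    {h : C(X, ℝ)} (hh : 0 ≤ h) :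
    ∃ s : ℝ, ∃ f : C(X, ℝ), 0 ≤ s ∧ 0 ≤ f ∧ s + ‖f‖ = 1 ∧
      ∀ x, f x = (∫ y, k x y * f y * (b y)⁻¹ ∂m) + s * h x := by
  have hwle : ∀ ε : ℝ, 0 < ε → ∀ᵐ y ∂m, (b y + ε)⁻¹ ≤ (b y)⁻¹ := by
    intro ε hε
    filter_upwards [hbae] with y hy
    exact inv_anti₀ hy (by linarith)
  have hw0 : ∀ ε : ℝ, 0 < ε → ∀ y, 0 ≤ (b y + ε)⁻¹ := fun ε hε y =>
    inv_nonneg.2 (by linarith [hb0 y])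
  have hw : ∀ ε : ℝ, 0 < ε → Integrable (fun y => (b y + ε)⁻¹) m := by
    intro ε hε
    have hc : Continuous fun y => (b y + ε)⁻¹ :=
      (b.continuous.add continuous_const).inv₀ fun y => (add_pos_of_nonneg_of_pos (hb0 y) hε).ne'
    refine hint.mono hc.aestronglyMeasurable ?_
    filter_upwards [hwle ε hε] with y hy
    rw [Real.norm_of_nonneg (hw0 ε hε y), Real.norm_of_nonneg (inv_nonneg.2 (hb0 y))]
    exact hy
  have hsol : ∀ ε : ℝ, ∀ hε : 0 < ε, ∃ g : C(X, ℝ), 0 ≤ g ∧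
      g = kernelOperator m k _ (hw ε hε) g + h := by
    intro ε hε
    have hε2 : 0 < ε / 2 := by positivity
    obtain ⟨ψ, hψ, hψsup⟩ := hsup (ε / 2) hε2
    set M := ‖b‖
    have hM : 0 ≤ M := norm_nonneg _
    -- The supersolution for `ε / 2` is strict for `ε`: the ratio `(t + ε / 2) / (t + ε)` increases
    -- in `t` and `b ≤ M`.
    have hθ : (M + ε / 2) / (M + ε) < 1 := by
      rw [div_lt_one (by positivity)]
      linarith
    refine exists_nonneg_eq_kernelOperator_add (hw ε hε) (Eventually.of_forall (hw0 ε hε)) hk hψ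
      (by positivity) hθ (fun x => ?_) hh
    change ∫ y, k x y * ψ y * (b y + ε)⁻¹ ∂m ≤ (M + ε / 2) / (M + ε) * ψ x
    refine le_trans ?_ (mul_le_mul_of_nonneg_left (hψsup x) (by positivity))
    rw [← integral_const_mul]
    refine integral_mono (integrable_kernel_mul (hw ε hε) _ _)
      ((integrable_kernel_mul (hw _ hε2) _ _).const_mul _) fun y => ?_
    have hby : b y ≤ M := (le_abs_self _).trans (b.norm_coe_le_norm y)
    have h1 : (b y + ε)⁻¹ ≤ (M + ε / 2) / (M + ε) * (b y + ε / 2)⁻¹ := by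
      have := hb0 y
      rw [← div_eq_mul_inv, div_div, inv_eq_one_div, div_le_div_iff₀ (by positivity) (by positivity)]
      nlinarith
    have h2 : 0 ≤ k x y * ψ y := mul_nonneg (hk x y) (hψ y).le
    calc k x y * ψ y * (b y + ε)⁻¹
        ≤ k x y * ψ y * ((M + ε / 2) / (M + ε) * (b y + ε / 2)⁻¹) :=
          mul_le_mul_of_nonneg_left h1 h2
      _ = _ := by ring
  have hεpos : ∀ j : ℕ, (0 : ℝ) < 1 / ((j : ℝ) + 1) := fun j => Nat.one_div_pos_of_nat
  choose g hg0 hg using fun j : ℕ => hsol _ (hεpos j)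
  set s : ℕ → ℝ := fun j => (1 + ‖g j‖)⁻¹ with hs
  have hspos : ∀ j, 0 < s j := fun j => by positivity
  have hs1 : ∀ j, s j ≤ 1 := fun j => inv_le_one_of_one_le₀ (by linarith [norm_nonneg (g j)])
  set f : ℕ → C(X, ℝ) := fun j => s j • g j with hf
  have hf0 : ∀ j, 0 ≤ f j := fun j => smul_nonneg (hspos j).le (hg0 j)
  have hsf : ∀ j, s j + ‖f j‖ = 1 := by
    intro j
    have h1 : (1 : ℝ) + ‖g j‖ ≠ 0 := by positivity
    rw [hf, norm_smul, Real.norm_of_nonneg (hspos j).le, hs]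
    field_simp
  have hfle : ∀ j, ‖f j‖ ≤ 1 := fun j => by linarith [hsf j, hspos j]
  have hfeq : ∀ j x, f j x
      = (∫ y, k x y * f j y * (b y + 1 / ((j : ℝ) + 1))⁻¹ ∂m) + s j * h x := by
    intro j x
    have h1 : f j = kernelOperator m k _ (hw _ (hεpos j)) (f j) + s j • h := by
      rw [hf, map_smul, ← smul_add, ← hg j]
    exact congrArg (fun u : C(X, ℝ) => u x) h1
  set W := ∫ y, (b y)⁻¹ ∂m with hW
  -- The weights are dominated by `1 / b`, so `W` bounds their integrals uniformly in `j`.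
  have hlip : ∀ j x x', dist (f j x) (f j x') ≤ dist (k x) (k x') * W + dist (h x) (h x') := by
    intro j x x'
    rw [hfeq j x, hfeq j x']
    refine (dist_add_add_le _ _ _ _).trans (add_le_add ?_ ?_)
    · rw [dist_eq_norm, dist_eq_norm, ← integral_sub (integrable_kernel_mul (hw _ (hεpos j)) _ _)
        (integrable_kernel_mul (hw _ (hεpos j)) _ _)]
      have h1 := norm_integral_kernel_mul_le (hw _ (hεpos j)) (k x - k x') (f j)
      have h2 : ∫ y, ‖(b y + 1 / ((j : ℝ) + 1))⁻¹‖ ∂m ≤ W := by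
        refine integral_mono_ae (hw _ (hεpos j)).norm hint ?_
        filter_upwards [hwle _ (hεpos j)] with y hy
        rwa [Real.norm_of_nonneg (hw0 _ (hεpos j) y)]
      have h3 : 0 ≤ ∫ y, ‖(b y + 1 / ((j : ℝ) + 1))⁻¹‖ ∂m :=
        integral_nonneg fun y => norm_nonneg _
      calc _ = ‖∫ y, (k x - k x') y * f j y * (b y + 1 / ((j : ℝ) + 1))⁻¹ ∂m‖ := by
            congr 2
            ext y
            simp only [ContinuousMap.sub_apply]
            ring
        _ ≤ ‖k x - k x'‖ * ‖f j‖ * ∫ y, ‖(b y + 1 / ((j : ℝ) + 1))⁻¹‖ ∂m := h1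
        _ ≤ ‖k x - k x'‖ * 1 * W := by
            gcongr
            exact hfle j
        _ = _ := by ring
    · rw [Real.dist_eq, ← mul_sub, abs_mul, abs_of_pos (hspos j), Real.dist_eq]
      exact mul_le_of_le_one_left (abs_nonneg _) (hs1 j)
  obtain ⟨F, φ, hφ, hF⟩ := exists_tendsto_subseq_of_dist_le hfle hlip
  have hFx : ∀ x, Tendsto (fun j => f (φ j) x) atTop (𝓝 (F x)) := fun x =>
    ((continuous_eval_const x).tendsto F).comp hF
  have hslim : Tendsto (fun j => s (φ j)) atTop (𝓝 (1 - ‖F‖)) := by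
    have h1 : (fun j => s (φ j)) = fun j => 1 - ‖f (φ j)‖ := by
      ext j
      linarith [hsf (φ j)]
    rw [h1]
    exact tendsto_const_nhds.sub hF.norm
  refine ⟨1 - ‖F‖, F, ge_of_tendsto' hslim fun j => (hspos _).le,
    fun x => ge_of_tendsto' (hFx x) fun j => hf0 _ x, by ring, fun x => ?_⟩
  refine tendsto_nhds_unique (hFx x) ?_
  rw [funext fun j => hfeq (φ j) x]
  refine Tendsto.add ?_ (hslim.mul_const _)
  refine tendsto_integral_of_dominated_convergence (fun y => ‖k x‖ * (b y)⁻¹)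
    (fun j => (integrable_kernel_mul (hw _ (hεpos _)) _ _).aestronglyMeasurable)
    (hint.const_mul _) (fun j => ?_) ?_
  · filter_upwards [hwle _ (hεpos (φ j))] with y hy
    rw [norm_mul, norm_mul, Real.norm_of_nonneg (hw0 _ (hεpos _) y)]
    have h1 := (k x).norm_coe_le_norm y
    have h2 := ((f (φ j)).norm_coe_le_norm y).trans (hfle _)
    have h3 := hw0 _ (hεpos (φ j)) y
    calc _ ≤ ‖k x‖ * 1 * (b y)⁻¹ := by gcongr
      _ = _ := by ring
  · filter_upwards [hbae] with y hy
    refine (tendsto_const_nhds.mul (hFx y)).mul (Tendsto.inv₀ ?_ hy.ne')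
    have h1 := tendsto_one_div_add_atTop_nhds_zero_nat (𝕜 := ℝ)
    simpa using (h1.comp hφ.tendsto_atTop).const_add (b y)

end Limit

/-! ### Supersolutions from the principal eigenvalue, and the density `g` -/

section Existence

variable {n : ℕ} {Ω : Set (EuclideanSpace ℝ (Fin n))}
  {K : EuclideanSpace ℝ (Fin n) → EuclideanSpace ℝ (Fin n) → ℝ}
  {a : EuclideanSpace ℝ (Fin n) → ℝ}

theorem le_supOn (hc : IsCompact (closure Ω)) (ha : ContinuousOn a (closure Ω))
    {x : EuclideanSpace ℝ (Fin n)} (hx : x ∈ closure Ω) : a x ≤ supOn a Ω := by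
  have hbdd : BddAbove (a '' Ω) :=
    (hc.image_of_continuousOn ha).bddAbove.mono (image_mono subset_closure)
  have h1 : closure (a '' Ω) ⊆ Iic (supOn a Ω) :=
    closure_minimal (fun _ hy => le_csSup hbdd hy) isClosed_Iic
  exact h1 (ha.image_closure (mem_image_of_mem a hx))

theorem maxSet_nonempty (hc : IsCompact (closure Ω)) (hne : Ω.Nonempty)
    (ha : ContinuousOn a (closure Ω)) : (maxSet a Ω).Nonempty := by
  obtain ⟨y, hy, hmax⟩ := hc.exists_isMaxOn hne.closure ha
  refine ⟨y, hy, le_antisymm (le_supOn hc ha hy) (csSup_le (hne.image a) ?_)⟩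
  rintro _ ⟨x, hx, rfl⟩
  exact hmax (subset_closure hx)

theorem exists_kernel_le (hc : IsCompact (closure Ω)) (hK : Continuous (Function.uncurry K)) :
    ∃ M, 0 ≤ M ∧ ∀ x ∈ closure Ω, ∀ y ∈ closure Ω, K x y ≤ M := by
  obtain ⟨M, hM⟩ := ((hc.prod hc).image hK).bddAbove
  refine ⟨max M 0, le_max_right _ _, fun x hx y hy => le_max_of_le_left ?_⟩
  exact hM ⟨(x, y), ⟨hx, hy⟩, rfl⟩

/-- The ball condition is open, so `x` is a limit of points of `Ω` still within `ε₀` of `y`; the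
strict bound survives as `≤`. This makes the supersolution positive on the boundary. -/
theorem le_kernel_of_mem_closure (hK : Continuous (Function.uncurry K)) {c₀ ε₀ : ℝ}
    (hpos : ∀ x ∈ Ω, ∀ y ∈ Metric.ball x ε₀, c₀ < K x y) {x : EuclideanSpace ℝ (Fin n)}
    (hx : x ∈ closure Ω) {y : EuclideanSpace ℝ (Fin n)} (hy : y ∈ Metric.ball x ε₀) :
    c₀ ≤ K x y := by
  have h1 : x ∈ closure (Ω ∩ Metric.ball y ε₀) :=
    Metric.isOpen_ball.closure_inter ⟨hx, Metric.mem_ball_comm.1 hy⟩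
  have hcl : IsClosed {z | c₀ ≤ K z y} :=
    isClosed_le continuous_const (hK.comp (by fun_prop : Continuous fun z => (z, y)))
  exact closure_minimal (fun z hz => (hpos z hz.1 y (Metric.mem_ball_comm.1 hz.2)).le) hcl h1

/-- A continuous function with all products `K x · φ` integrable is integrable, since `K` is
bounded below near the diagonal. -/
theorem integrableOn_of_integrableOn_kernel_mul (hc : IsCompact (closure Ω)) (ho : IsOpen Ω)
    {c₀ ε₀ : ℝ} (hc₀ : 0 < c₀) (hε₀ : 0 < ε₀)
    (hpos : ∀ x ∈ Ω, ∀ y ∈ Metric.ball x ε₀, c₀ < K x y)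
    {φ : EuclideanSpace ℝ (Fin n) → ℝ} (hφ : ContinuousOn φ Ω)
    (hint : ∀ x ∈ Ω, IntegrableOn (fun y => K x y * φ y) Ω) : IntegrableOn φ Ω := by
  have hloc : LocallyIntegrableOn φ (closure Ω) (volume.restrict Ω) := by
    intro x hx
    -- On the ball around a nearby `z ∈ Ω`, which contains `x`, `|φ|` is at most `c₀⁻¹ |K z · φ|`.
    obtain ⟨z, hz, hzx⟩ := Metric.mem_closure_iff.1 hx ε₀ hε₀
    refine ⟨Metric.ball z ε₀, mem_nhdsWithin_of_mem_nhds
      (Metric.isOpen_ball.mem_nhds (by simpa using hzx)), ?_⟩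
    refine Integrable.mono' (((hint z hz).norm.const_mul c₀⁻¹).integrableOn (s := Metric.ball z ε₀))
      (hφ.aestronglyMeasurable ho.measurableSet).restrict ?_
    refine (ae_restrict_mem Metric.isOpen_ball.measurableSet).mono fun y hy => ?_
    have h1 := hpos z hz y hy
    have h2 : 0 < K z y := hc₀.trans h1
    rw [norm_mul, Real.norm_of_nonneg h2.le, inv_mul_eq_div, le_div_iff₀ hc₀, mul_comm]
    exact mul_le_mul_of_nonneg_right h1.le (norm_nonneg _)
  have h := hloc.integrableOn_isCompact hc
  rwa [IntegrableOn, Measure.restrict_restrict hc.isClosed.measurableSet,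
    inter_eq_right.2 subset_closure] at h

/-- Admissible values approximate the generalised principal eigenvalue of a bounded open set. -/
theorem exists_lt_of_lt_principalEigenvalue (hc : IsCompact (closure Ω)) (ho : IsOpen Ω)
    (hK : Continuous (Function.uncurry K))
    (ha : ContinuousOn a (closure Ω)) {r : ℝ} (hr : r < principalEigenvalue K a Ω) :
    ∃ lam, r < lam ∧ ∃ φ : EuclideanSpace ℝ (Fin n) → ℝ,
      ContinuousOn φ Ω ∧ (∀ x ∈ Ω, 0 < φ x) ∧
      ∀ x ∈ Ω, IntegrableOn (fun y => K x y * φ y) Ω ∧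
        (∫ y in Ω, K x y * φ y) + a x * φ x + lam * φ x ≤ 0 := by
  have hfin : volume Ω < ⊤ := (measure_mono subset_closure).trans_lt hc.measure_lt_top
  obtain ⟨M, hM0, hM⟩ := exists_kernel_le hc hK
  suffices hne : {lam : ℝ | ∃ φ : EuclideanSpace ℝ (Fin n) → ℝ,
      ContinuousOn φ Ω ∧ (∀ x ∈ Ω, 0 < φ x) ∧
      ∀ x ∈ Ω, IntegrableOn (fun y => K x y * φ y) Ω ∧
        (∫ y in Ω, K x y * φ y) + a x * φ x + lam * φ x ≤ 0}.Nonempty by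
    obtain ⟨lam, hlam, hr'⟩ := exists_lt_of_lt_csSup hne hr
    exact ⟨lam, hr', hlam⟩
  refine ⟨-(M * volume.real Ω + supOn a Ω), fun _ => 1, continuousOn_const,
    fun _ _ => one_pos, fun x hx => ?_⟩
  have hint : IntegrableOn (fun y => K x y * 1) Ω := by
    simp only [mul_one]
    refine IntegrableOn.mono_set (t := closure Ω) ?_ subset_closure
    exact (hK.comp (by fun_prop : Continuous fun y => (x, y))).continuousOn.integrableOn_compact hc
  refine ⟨hint, ?_⟩
  have h1 : ∫ y in Ω, K x y * 1 ≤ M * volume.real Ω := by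
    refine (setIntegral_mono_on hint (integrableOn_const (C := M) hfin.ne) ho.measurableSet
      fun y hy => ?_).trans (le_of_eq ?_)
    · simpa using hM x (subset_closure hx) y (subset_closure hy)
    · simp [mul_comm]
  have h2 := le_supOn hc ha (subset_closure hx)
  linarith

/-- Admissible functions can be regularised to supersolutions that are continuous and positive
up to the boundary. -/
theorem exists_supersolution (hc : IsCompact (closure Ω)) (ho : IsOpen Ω)
    (hK : Continuous (Function.uncurry K)) (hK0 : ∀ x y, 0 ≤ K x y)
    (hpos : ∃ c₀ > 0, ∃ ε₀ > 0, ∀ x ∈ Ω, ∀ y ∈ Metric.ball x ε₀, c₀ < K x y)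
    (ha : ContinuousOn a (closure Ω))
    (hlam : principalEigenvalue K a Ω = -supOn a Ω) {ε : ℝ} (hε : 0 < ε) :
    ∃ ψ : EuclideanSpace ℝ (Fin n) → ℝ, ContinuousOn ψ (closure Ω) ∧
      (∀ x ∈ closure Ω, 0 < ψ x) ∧
      ∀ x ∈ closure Ω, ∫ y in Ω, K x y * ψ y * (supOn a Ω - a y + ε)⁻¹ ≤ ψ x := by
  obtain ⟨c₀, hc₀, ε₀, hε₀, hpos⟩ := hpos
  obtain ⟨lam, hlt, φ, hφ, hφ0, hφK⟩ := exists_lt_of_lt_principalEigenvalue hc ho hK ha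
    (r := -supOn a Ω - ε) (by linarith)
  have hφint : IntegrableOn φ Ω :=
    integrableOn_of_integrableOn_kernel_mul hc ho hc₀ hε₀ hpos hφ fun x hx => (hφK x hx).1
  obtain ⟨M, hM0, hM⟩ := exists_kernel_le hc hK
  have hKx : ∀ x, Continuous fun y => K x y := fun x =>
    hK.comp (by fun_prop : Continuous fun y => (x, y))
  have hKy : ∀ y, Continuous fun x => K x y := fun y =>
    hK.comp (by fun_prop : Continuous fun x => (x, y))
  have hmeas : ∀ x, AEStronglyMeasurable (fun y => K x y * φ y) (volume.restrict Ω) := fun x =>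
    (hKx x).aestronglyMeasurable.mul (hφ.aestronglyMeasurable ho.measurableSet)
  have hbound : ∀ x ∈ closure Ω, ∀ᵐ y ∂volume.restrict Ω, ‖K x y * φ y‖ ≤ M * φ y := by
    intro x hx
    refine (ae_restrict_mem ho.measurableSet).mono fun y hy => ?_
    rw [Real.norm_of_nonneg (mul_nonneg (hK0 x y) (hφ0 y hy).le)]
    exact mul_le_mul_of_nonneg_right (hM x hx y (subset_closure hy)) (hφ0 y hy).le
  have hint : ∀ x ∈ closure Ω, IntegrableOn (fun y => K x y * φ y) Ω := fun x hx =>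
    (hφint.const_mul M).mono' (hmeas x) (hbound x hx)
  have hcont : ContinuousOn (fun x => ∫ y in Ω, K x y * φ y) (closure Ω) :=
    continuousOn_of_dominated (fun x _ => hmeas x) hbound (hφint.const_mul M)
      (Eventually.of_forall fun y => ((hKy y).mul continuous_const).continuousOn)
  -- Admissibility reads `ψ / (b + ε) ≤ φ` for `ψ = ∫ K φ`; integrating against `K` gives the
  -- supersolution inequality.
  refine ⟨fun x => ∫ y in Ω, K x y * φ y, hcont, fun x hx => ?_, fun x hx => ?_⟩
  · rw [setIntegral_pos_iff_support_of_nonneg_ae ?_ (hint x hx)]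
    · obtain ⟨z, hz, hzx⟩ := Metric.mem_closure_iff.1 hx ε₀ hε₀
      refine ((Metric.isOpen_ball.inter ho).measure_pos volume
        ⟨z, Metric.mem_ball'.2 hzx, hz⟩).trans_le (measure_mono ?_)
      rintro y ⟨hy, hyΩ⟩
      exact ⟨(mul_pos (hc₀.trans_le (le_kernel_of_mem_closure hK hpos hx hy)) (hφ0 y hyΩ)).ne',
        hyΩ⟩
    · exact (ae_restrict_mem ho.measurableSet).mono fun y hy => mul_nonneg (hK0 x y) (hφ0 y hy).le
  · refine integral_mono_of_nonneg ?_ (hint x hx) ?_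
    · refine (ae_restrict_mem ho.measurableSet).mono fun y hy => ?_
      refine mul_nonneg (mul_nonneg (hK0 x y) ?_) (inv_nonneg.2 ?_)
      · exact setIntegral_nonneg ho.measurableSet fun z hz => mul_nonneg (hK0 y z) (hφ0 z hz).le
      · linarith [le_supOn hc ha (subset_closure hy)]
    · refine (ae_restrict_mem ho.measurableSet).mono fun y hy => ?_
      have h1 := (hφK y hy).2
      have h2 : 0 < supOn a Ω - a y + ε := by linarith [le_supOn hc ha (subset_closure hy)]
      have h3 : ∫ z in Ω, K y z * φ z ≤ φ y * (supOn a Ω - a y + ε) := by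
        nlinarith [hφ0 y hy]
      change K x y * (∫ z in Ω, K y z * φ z) * (supOn a Ω - a y + ε)⁻¹ ≤ K x y * φ y
      rw [mul_assoc, ← div_eq_mul_inv]
      exact mul_le_mul_of_nonneg_left ((div_le_iff₀ h2).2 h3) (hK0 x y)

/-- For every source point the integral equation has a nontrivial nonnegative solution, with a
source strength that may vanish. -/
theorem exists_density (hc : IsCompact (closure Ω)) (ho : IsOpen Ω)
    (hK : Continuous (Function.uncurry K)) (hK0 : ∀ x y, 0 ≤ K x y)
    (hpos : ∃ c₀ > 0, ∃ ε₀ > 0, ∀ x ∈ Ω, ∀ y ∈ Metric.ball x ε₀, c₀ < K x y)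
    (ha : ContinuousOn a (closure Ω))
    (hint : ∫⁻ x in Ω, (ENNReal.ofReal (supOn a Ω - a x))⁻¹ < ⊤)
    (hlam : principalEigenvalue K a Ω = -supOn a Ω) (x₀ : EuclideanSpace ℝ (Fin n)) :
    ∃ (s : ℝ) (g : EuclideanSpace ℝ (Fin n) → ℝ), 0 ≤ s ∧ ContinuousOn g (closure Ω) ∧
      (∀ x ∈ closure Ω, 0 ≤ g x) ∧ (s ≠ 0 ∨ ∃ x ∈ closure Ω, g x ≠ 0) ∧
      ∀ x ∈ closure Ω, g x = (∫ y in Ω, K x y * g y * (supOn a Ω - a y)⁻¹) + s * K x x₀ := by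
  have : CompactSpace (closure Ω) := isCompact_iff_compactSpace.1 hc
  have hcm := hc.isClosed.measurableSet
  -- The boundary of `Ω` may have positive Lebesgue measure, so restriction to `Ω` precedes the
  -- passage to the closure.
  set m : Measure (closure Ω) := Measure.comap Subtype.val (volume.restrict Ω)
  have hres : (volume.restrict Ω).restrict (closure Ω) = volume.restrict Ω := by
    rw [Measure.restrict_restrict hcm, inter_eq_right.2 subset_closure]
  have hI : ∀ f : EuclideanSpace ℝ (Fin n) → ℝ, ∫ y, f y.1 ∂m = ∫ y in Ω, f y := fun f => by
    rw [integral_subtype_comap hcm, hres]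
  set k : C(closure Ω, C(closure Ω, ℝ)) := ContinuousMap.curry
    ⟨fun p => K p.1.1 p.2.1, hK.comp (by fun_prop :
      Continuous fun p : closure Ω × closure Ω => (p.1.1, p.2.1))⟩
  set b : C(closure Ω, ℝ) := ⟨fun x => supOn a Ω - a x.1,
    continuous_const.sub (continuousOn_iff_continuous_domRestrict.1 ha)⟩
  have hb0 : ∀ x, 0 ≤ b x := fun x => sub_nonneg.2 (le_supOn hc ha x.2)
  obtain ⟨hbae, hbint⟩ := integrable_inv_of_lintegral_inv_lt_top (m := m)
    b.continuous.aestronglyMeasurable (Eventually.of_forall hb0) (by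
      have h1 := lintegral_subtype_comap (μ := volume.restrict Ω) hcm
        (fun x => (ENNReal.ofReal (supOn a Ω - a x))⁻¹)
      rw [hres] at h1
      exact h1.trans_lt hint)
  obtain ⟨s, f, hs, hf, hsf, heq⟩ := exists_eq_kernelOperator_inv_add (m := m) (k := k)
    (fun x y => hK0 x y) hb0 hbae hbint (fun ε hε => by
      obtain ⟨ψ, hψ, hψ0, hψs⟩ := exists_supersolution hc ho hK hK0 hpos ha hlam hε
      refine ⟨⟨fun x => ψ x.1, continuousOn_iff_continuous_domRestrict.1 hψ⟩,
        fun x => hψ0 x x.2, fun x => ?_⟩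
      refine le_trans (le_of_eq ?_) (hψs x x.2)
      exact hI fun y => K x y * ψ y * (supOn a Ω - a y + ε)⁻¹)
    (h := ⟨fun x => K x.1 x₀, hK.comp (by fun_prop : Continuous fun x : closure Ω => (x.1, x₀))⟩)
    (fun x => hK0 x x₀)
  have hext : ∀ x : closure Ω, Function.extend Subtype.val f 0 x.1 = f x := fun x =>
    Subtype.val_injective.extend_apply _ _ _
  refine ⟨s, Function.extend Subtype.val f 0, hs, ?_, fun x hx => ?_, ?_, fun x hx => ?_⟩
  · rw [continuousOn_iff_continuous_domRestrict]
    exact f.continuous.congr fun x => (hext x).symm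
  · exact (hf ⟨x, hx⟩).trans_eq (hext ⟨x, hx⟩).symm
  · by_contra! h
    have hf0 : f = 0 := by
      ext x
      exact (hext x).symm.trans (h.2 x x.2)
    rw [h.1, hf0, norm_zero, add_zero] at hsf
    exact zero_ne_one hsf
  · rw [← hI fun y => K x y * Function.extend Subtype.val f 0 y * (supOn a Ω - a y)⁻¹]
    simp only [hext]
    exact (hext ⟨x, hx⟩).trans (heq ⟨x, hx⟩)

end Existence

/-! ### Measure solutions: cone structure and construction from a density -/

section Solution

variable {n : ℕ} {Ω : Set (EuclideanSpace ℝ (Fin n))}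
  {K : EuclideanSpace ℝ (Fin n) → EuclideanSpace ℝ (Fin n) → ℝ}
  {a : EuclideanSpace ℝ (Fin n) → ℝ}

theorem IsPositiveMeasureSolution.smul {lam : ℝ} {μ : Measure (EuclideanSpace ℝ (Fin n))}
    (hμ : IsPositiveMeasureSolution K a Ω lam μ) {c : ENNReal} (hc0 : c ≠ 0) (hc : c ≠ ⊤) :
    IsPositiveMeasureSolution K a Ω lam (c • μ) where
  finite := by
    have := hμ.finite
    exact Measure.smul_finite μ hc
  concentrated := by simp [hμ.concentrated]
  ne_zero := by
    intro h
    refine hμ.ne_zero (Measure.measure_univ_eq_zero.1 ?_)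
    have h1 := congrArg (fun ν : Measure _ => ν univ) h
    simpa [hc0] using h1
  equation B hB := by
    simp only [Measure.restrict_smul, integral_smul_measure, smul_eq_mul]
    rw [integral_const_mul, ← mul_add, hμ.equation B hB, mul_zero]

theorem IsPositiveMeasureSolution.add (hcpt : IsCompact (closure Ω))
    (hK : Continuous (Function.uncurry K)) (ha : ContinuousOn a (closure Ω)) {lam : ℝ}
    {μ ν : Measure (EuclideanSpace ℝ (Fin n))}
    (hμ : IsPositiveMeasureSolution K a Ω lam μ) (hν : IsPositiveMeasureSolution K a Ω lam ν) :
    IsPositiveMeasureSolution K a Ω lam (μ + ν) := by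
  have := hμ.finite
  have := hν.finite
  have hKx : ∀ (ρ : Measure (EuclideanSpace ℝ (Fin n))) [IsFiniteMeasure ρ], ∀ x,
      IntegrableOn (fun y => K x y) (closure Ω) ρ := fun ρ _ x =>
    (hK.comp (by fun_prop : Continuous fun y => (x, y))).continuousOn.integrableOn_compact hcpt
  have hG : ∀ (ρ : Measure (EuclideanSpace ℝ (Fin n))) [IsFiniteMeasure ρ],
      IntegrableOn (fun x => ∫ y in closure Ω, K x y ∂ρ) (closure Ω) := by
    intro ρ _
    obtain ⟨M, hM⟩ := ((hcpt.prod hcpt).image hK.norm).bddAbove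
    refine ContinuousOn.integrableOn_compact hcpt ?_
    refine continuousOn_of_dominated (bound := fun _ => M)
      (fun x _ => (hKx ρ x).aestronglyMeasurable) (fun x hx => ?_) (integrable_const M)
      (Eventually.of_forall fun y =>
        (hK.comp (by fun_prop : Continuous fun x => (x, y))).continuousOn)
    exact (ae_restrict_mem hcpt.isClosed.measurableSet).mono fun y hy => hM ⟨(x, y), ⟨hx, hy⟩, rfl⟩
  have haint : ∀ (ρ : Measure (EuclideanSpace ℝ (Fin n))) [IsFiniteMeasure ρ],
      IntegrableOn (fun x => a x + lam) (closure Ω) ρ := fun ρ _ =>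
    (ha.add continuousOn_const).integrableOn_compact hcpt
  refine ⟨inferInstance, by simp [hμ.concentrated, hν.concentrated], ?_, fun B hB => ?_⟩
  · intro h
    refine hμ.ne_zero (Measure.measure_univ_eq_zero.1 ?_)
    have h1 := congrArg (fun ν : Measure _ => ν univ) h
    simp only [Measure.coe_add, Pi.add_apply, Measure.coe_zero, Pi.zero_apply,
      add_eq_zero] at h1
    exact h1.1
  · have h1 : ∀ x, ∫ y in closure Ω, K x y ∂(μ + ν)
        = (∫ y in closure Ω, K x y ∂μ) + ∫ y in closure Ω, K x y ∂ν := fun x => by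
      rw [Measure.restrict_add, integral_add_measure (hKx μ x) (hKx ν x)]
    simp only [h1]
    have hsub : B ∩ Ω ⊆ closure Ω := inter_subset_right.trans subset_closure
    rw [integral_add ((hG μ).mono_set hsub) ((hG ν).mono_set hsub), Measure.restrict_add,
      integral_add_measure ((haint μ).mono_set inter_subset_right)
        ((haint ν).mono_set inter_subset_right)]
    linarith [hμ.equation B hB, hν.equation B hB]

/-- A nontrivial solution of the integral equation with source `s K(·, x₀)` yields a positive
measure solution with an atom of mass `s` at a maximum point `x₀`. -/
theorem isPositiveMeasureSolution_diracPlusDensity (hc : IsCompact (closure Ω)) (ho : IsOpen Ω)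
    (hK : Continuous (Function.uncurry K)) (ha : ContinuousOn a (closure Ω))
    (hint : ∫⁻ x in Ω, (ENNReal.ofReal (supOn a Ω - a x))⁻¹ < ⊤)
    {x₀ : EuclideanSpace ℝ (Fin n)} (hx₀ : x₀ ∈ maxSet a Ω) {s : ℝ} (hs : 0 ≤ s)
    {g : EuclideanSpace ℝ (Fin n) → ℝ} (hg : ContinuousOn g (closure Ω))
    (hg0 : ∀ x ∈ closure Ω, 0 ≤ g x) (hne : s ≠ 0 ∨ ∃ x ∈ closure Ω, g x ≠ 0)
    (heq : ∀ x ∈ closure Ω,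
      g x = (∫ y in Ω, K x y * g y * (supOn a Ω - a y)⁻¹) + s * K x x₀) :
    IsPositiveMeasureSolution K a Ω (-supOn a Ω) (diracPlusDensity a Ω s x₀ g) := by
  have hcm := hc.isClosed.measurableSet
  have hle : ∀ x ∈ closure Ω, a x ≤ supOn a Ω := fun x hx => le_supOn hc ha hx
  have hbm : AEStronglyMeasurable (fun x => supOn a Ω - a x) (volume.restrict Ω) :=
    ((continuousOn_const.sub ha).mono subset_closure).aestronglyMeasurable ho.measurableSet
  obtain ⟨hbae, hbint⟩ := integrable_inv_of_lintegral_inv_lt_top hbm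
    ((ae_restrict_mem ho.measurableSet).mono fun x hx =>
      sub_nonneg.2 (hle x (subset_closure hx))) hint
  have hp0 : ∀ x ∈ Ω, 0 ≤ g x / (supOn a Ω - a x) := fun x hx =>
    div_nonneg (hg0 x (subset_closure hx)) (sub_nonneg.2 (hle x (subset_closure hx)))
  have hpint : IntegrableOn (fun x => g x / (supOn a Ω - a x)) Ω := by
    obtain ⟨M, hM⟩ := (hc.image_of_continuousOn hg.norm).bddAbove
    exact hbint.bdd_mul (c := M)
      ((hg.mono subset_closure).aestronglyMeasurable ho.measurableSet)
      ((ae_restrict_mem ho.measurableSet).mono fun x hx => hM ⟨x, subset_closure hx, rfl⟩)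
  set D := (volume.restrict Ω).withDensity
    (fun x => ENNReal.ofReal (g x / (supOn a Ω - a x))) with hD
  have hμ : diracPlusDensity a Ω s x₀ g = ENNReal.ofReal s • Measure.dirac x₀ + D := rfl
  have hDfin : IsFiniteMeasure D := isFiniteMeasure_withDensity_ofReal hpint.2
  have hfin₁ : IsFiniteMeasure (ENNReal.ofReal s • Measure.dirac x₀) :=
    Measure.smul_finite _ ENNReal.ofReal_ne_top
  have hDint : ∀ (B : Set (EuclideanSpace ℝ (Fin n))), MeasurableSet B →
      ∀ G : EuclideanSpace ℝ (Fin n) → ℝ,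
      ∫ x in B, G x ∂D = ∫ x in B ∩ Ω, g x / (supOn a Ω - a x) * G x := by
    intro B hB G
    rw [hD, restrict_withDensity hB, Measure.restrict_restrict hB,
      integral_withDensity_eq_integral_toReal_smul₀ _
        (Eventually.of_forall fun x => ENNReal.ofReal_lt_top)]
    · refine setIntegral_congr_fun (hB.inter ho.measurableSet) fun x hx => ?_
      simp only [ENNReal.toReal_ofReal (hp0 x hx.2), smul_eq_mul]
    · exact (hpint.mono_set inter_subset_right).aemeasurable.ennreal_ofReal
  have hsplit : ∀ (B : Set (EuclideanSpace ℝ (Fin n))), MeasurableSet B → B ⊆ closure Ω →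
      ∀ G : EuclideanSpace ℝ (Fin n) → ℝ, ContinuousOn G (closure Ω) →
      ∫ x in B, G x ∂(diracPlusDensity a Ω s x₀ g)
        = s * (∫ x in B, G x ∂Measure.dirac x₀)
          + ∫ x in B ∩ Ω, g x / (supOn a Ω - a x) * G x := by
    intro B hB hBc G hG
    rw [hμ, Measure.restrict_add, integral_add_measure, Measure.restrict_smul,
      integral_smul_measure, ENNReal.toReal_ofReal hs, smul_eq_mul, hDint B hB]
    · exact (hG.integrableOn_compact hc).mono_set hBc
    · exact (hG.integrableOn_compact hc).mono_set hBc
  -- The integral equation says exactly that the potential of the measure is `g`.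
  have hKint : ∀ x ∈ closure Ω,
      ∫ y in closure Ω, K x y ∂(diracPlusDensity a Ω s x₀ g) = g x := by
    intro x hx
    classical
    rw [hsplit _ hcm subset_rfl (fun y => K x y)
      (hK.comp (by fun_prop : Continuous fun y => (x, y))).continuousOn, setIntegral_dirac,
      if_pos hx₀.1, inter_eq_right.2 subset_closure, heq x hx, add_comm]
    congr 2
    ext y
    ring
  refine ⟨hμ ▸ inferInstance, ?_, fun h => ?_, fun B hB => ?_⟩
  · rw [hμ, Measure.add_apply, Measure.smul_apply,
      Measure.dirac_apply' _ hcm.compl, indicator_of_notMem (notMem_compl_iff.2 hx₀.1), smul_zero, zero_add]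
    refine withDensity_absolutelyContinuous _ _ ?_
    rw [Measure.restrict_apply hcm.compl]
    refine measure_mono_null ?_ measure_empty
    exact fun x hx => hx.1 (subset_closure hx.2)
  · have hgz : ∀ x ∈ closure Ω, g x = 0 := fun x hx => by
      rw [← hKint x hx, h, Measure.restrict_zero, integral_zero_measure]
    rcases hne with hs0 | ⟨x, hx, hgx⟩
    · have h1 := congrArg (fun ν : Measure _ => ν {x₀}) h
      simp only [hμ, Measure.coe_add, Pi.add_apply, Measure.smul_apply, Measure.coe_zero,
        Pi.zero_apply, add_eq_zero, Measure.dirac_apply_of_mem (mem_singleton x₀), smul_eq_mul,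
        mul_one, ENNReal.ofReal_eq_zero] at h1
      exact hs0 (le_antisymm h1.1 hs)
    · exact hgx (hgz x hx)
  · classical
    have h1 : ∫ x in B ∩ Ω, ∫ y in closure Ω, K x y ∂(diracPlusDensity a Ω s x₀ g)
        = ∫ x in B ∩ Ω, g x :=
      setIntegral_congr_fun (hB.inter ho.measurableSet) fun x hx =>
        hKint x (subset_closure hx.2)
    have h2 : ∫ x in B ∩ Ω, g x / (supOn a Ω - a x) * (a x + -supOn a Ω)
        = ∫ x in B ∩ Ω, -g x := by
      refine integral_congr_ae ?_
      filter_upwards [ae_mono (Measure.restrict_mono inter_subset_right le_rfl) hbae] with x hx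
      field_simp
      ring
    -- The atom contributes nothing, because `a x₀ - A = 0`; the density contributes `-g`, which
    -- cancels the potential.
    rw [h1, hsplit _ (hB.inter hcm) inter_subset_right (fun x => a x + -supOn a Ω)
        (ha.add continuousOn_const),
      setIntegral_dirac, inter_assoc, inter_eq_right.2 (subset_closure (s := Ω)), h2, hx₀.2,
      integral_neg]
    simp

/-- Two different solutions of mass one span infinitely many. -/
theorem infinite_solutions_of_ne (hc : IsCompact (closure Ω))
    (hK : Continuous (Function.uncurry K)) (ha : ContinuousOn a (closure Ω)) {lam : ℝ}
    {μ ν : Measure (EuclideanSpace ℝ (Fin n))} [IsProbabilityMeasure μ] [IsProbabilityMeasure ν]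
    (hμ : IsPositiveMeasureSolution K a Ω lam μ) (hν : IsPositiveMeasureSolution K a Ω lam ν)
    (hne : μ ≠ ν) :
    {ρ | IsPositiveMeasureSolution K a Ω lam ρ ∧ IsProbabilityMeasure ρ}.Infinite := by
  set F : ℝ → Measure (EuclideanSpace ℝ (Fin n)) := fun t =>
    ENNReal.ofReal t • μ + ENNReal.ofReal (1 - t) • ν with hF
  refine infinite_of_injOn_mapsTo (f := F) (s := Ioo (0 : ℝ) 1) ?_ ?_
    (Ioo_infinite one_pos)
  · obtain ⟨B, hB, hBne⟩ : ∃ B, MeasurableSet B ∧ μ.real B ≠ ν.real B := by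
      by_contra! h
      refine hne (Measure.ext fun B hB => ?_)
      exact (measureReal_eq_measureReal_iff).1 (h B hB)
    have hFB : ∀ t ∈ Ioo (0 : ℝ) 1, (F t B).toReal = t * μ.real B + (1 - t) * ν.real B := by
      intro t ht
      rw [hF, Measure.add_apply, Measure.smul_apply, Measure.smul_apply, smul_eq_mul, smul_eq_mul,
        ENNReal.toReal_add (by finiteness) (by finiteness), ENNReal.toReal_mul,
        ENNReal.toReal_mul, ENNReal.toReal_ofReal ht.1.le,
        ENNReal.toReal_ofReal (sub_pos.2 ht.2).le]
      rfl
    intro t ht u hu htu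
    have h1 := hFB t ht
    rw [htu, hFB u hu] at h1
    have h2 : (u - t) * (μ.real B - ν.real B) = 0 := by linarith
    rcases mul_eq_zero.1 h2 with h3 | h3
    · linarith
    · exact absurd (sub_eq_zero.1 h3) hBne
  · intro t ht
    refine ⟨(hμ.smul ?_ ENNReal.ofReal_ne_top).add hc hK ha
      (hν.smul ?_ ENNReal.ofReal_ne_top), ⟨?_⟩⟩
    · exact (ENNReal.ofReal_pos.2 ht.1).ne'
    · exact (ENNReal.ofReal_pos.2 (sub_pos.2 ht.2)).ne'
    · simp only [hF, Measure.add_apply, Measure.smul_apply, measure_univ, smul_eq_mul, mul_one]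
      rw [← ENNReal.ofReal_add ht.1.le (sub_pos.2 ht.2).le]
      simp

theorem IsPositiveMeasureSolution.normalize {lam : ℝ} {μ : Measure (EuclideanSpace ℝ (Fin n))}
    (hμ : IsPositiveMeasureSolution K a Ω lam μ) :
    IsPositiveMeasureSolution K a Ω lam ((μ univ)⁻¹ • μ) ∧
      IsProbabilityMeasure ((μ univ)⁻¹ • μ) := by
  have := hμ.finite
  have : NeZero μ := ⟨hμ.ne_zero⟩
  exact ⟨hμ.smul (ENNReal.inv_ne_zero.2 (measure_ne_top μ univ))
    (ENNReal.inv_ne_top.2 (Measure.measure_univ_ne_zero.2 hμ.ne_zero)), inferInstance⟩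

end Solution

end NonlocalOperator

/-- The integral in `hint` is taken in `[0, ∞]` with `1 / 0 = ∞`. In the last part "singular" means
"not absolutely continuous", and the solutions are normalised to have mass one, so that scalar
multiples of one solution do not count as different. -/
theorem mainTheorem1 {n : ℕ} (Ω : Set (EuclideanSpace ℝ (Fin n)))
    (hΩ_open : IsOpen Ω) (hΩ_bdd : Bornology.IsBounded Ω) (hΩ_ne : Ω.Nonempty)
    (K : EuclideanSpace ℝ (Fin n) → EuclideanSpace ℝ (Fin n) → ℝ)
    (hK_cont : Continuous (Function.uncurry K)) (hK_nonneg : ∀ x y, 0 ≤ K x y)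
    (hK_pos : ∃ c₀ > 0, ∃ ε₀ > 0, ∀ x ∈ Ω, ∀ y ∈ Metric.ball x ε₀, c₀ < K x y)
    (a : EuclideanSpace ℝ (Fin n) → ℝ) (ha : ContinuousOn a (closure Ω))
    (hint : ∫⁻ x in Ω, (ENNReal.ofReal (NonlocalOperator.supOn a Ω - a x))⁻¹ < ⊤)
    (hlam : NonlocalOperator.principalEigenvalue K a Ω = -NonlocalOperator.supOn a Ω) :
    (∃ μ : Measure (EuclideanSpace ℝ (Fin n)),
      NonlocalOperator.IsPositiveMeasureSolution K a Ω
        (NonlocalOperator.principalEigenvalue K a Ω) μ) ∧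
    (∀ x₀ ∈ NonlocalOperator.maxSet a Ω,
      ∃ (α : ℝ) (g : EuclideanSpace ℝ (Fin n) → ℝ),
        0 ≤ α ∧ ContinuousOn g (closure Ω) ∧ (∀ x ∈ closure Ω, 0 ≤ g x) ∧
        NonlocalOperator.IsPositiveMeasureSolution K a Ω
          (NonlocalOperator.principalEigenvalue K a Ω)
          (NonlocalOperator.diracPlusDensity a Ω α x₀ g)) ∧
    (∀ μ : Measure (EuclideanSpace ℝ (Fin n)),
      NonlocalOperator.IsPositiveMeasureSolution K a Ω
        (NonlocalOperator.principalEigenvalue K a Ω) μ →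
      ¬ μ ≪ (volume : Measure (EuclideanSpace ℝ (Fin n))) →
      (NonlocalOperator.maxSet a Ω).Nontrivial →
      {ν : Measure (EuclideanSpace ℝ (Fin n)) |
        NonlocalOperator.IsPositiveMeasureSolution K a Ω
          (NonlocalOperator.principalEigenvalue K a Ω) ν ∧ IsProbabilityMeasure ν}.Infinite) := by
  have hc : IsCompact (closure Ω) := hΩ_bdd.isCompact_closure
  rw [hlam]
  have hsol : ∀ x₀ ∈ NonlocalOperator.maxSet a Ω,
      ∃ (α : ℝ) (g : EuclideanSpace ℝ (Fin n) → ℝ),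
        0 ≤ α ∧ ContinuousOn g (closure Ω) ∧ (∀ x ∈ closure Ω, 0 ≤ g x) ∧
        NonlocalOperator.IsPositiveMeasureSolution K a Ω (-NonlocalOperator.supOn a Ω)
          (NonlocalOperator.diracPlusDensity a Ω α x₀ g) := by
    intro x₀ hx₀
    obtain ⟨s, g, hs, hg, hg0, hne, heq⟩ := NonlocalOperator.exists_density hc hΩ_open hK_cont
      hK_nonneg hK_pos ha hint hlam x₀
    exact ⟨s, g, hs, hg, hg0, NonlocalOperator.isPositiveMeasureSolution_diracPlusDensity hc
      hΩ_open hK_cont ha hint hx₀ hs hg hg0 hne heq⟩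
  refine ⟨?_, hsol, fun μ hμ hsing hnt => ?_⟩
  · obtain ⟨x₀, hx₀⟩ := NonlocalOperator.maxSet_nonempty hc hΩ_ne ha
    obtain ⟨α, g, -, -, -, h⟩ := hsol x₀ hx₀
    exact ⟨_, h⟩
  · by_contra hfin
    -- Finiteness makes the normalised solutions coincide; only the resulting absolute continuity is
    -- needed.
    have huniq : ∀ μ₁ μ₂ : Measure (EuclideanSpace ℝ (Fin n)),
        NonlocalOperator.IsPositiveMeasureSolution K a Ω (-NonlocalOperator.supOn a Ω) μ₁ →
        NonlocalOperator.IsPositiveMeasureSolution K a Ω (-NonlocalOperator.supOn a Ω) μ₂ →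
        μ₁ ≪ μ₂ := by
      intro μ₁ μ₂ h₁ h₂
      obtain ⟨h₁', hp₁⟩ := h₁.normalize
      obtain ⟨h₂', hp₂⟩ := h₂.normalize
      have heq : (μ₁ univ)⁻¹ • μ₁ = (μ₂ univ)⁻¹ • μ₂ := by
        by_contra hne
        exact hfin (NonlocalOperator.infinite_solutions_of_ne hc hK_cont ha h₁' h₂' hne)
      have := h₁.finite
      intro B hB
      have h3 := congrArg (fun ν : Measure _ => ν B) heq
      simp only [Measure.smul_apply, hB, smul_eq_mul, mul_zero] at h3
      exact (mul_eq_zero.1 h3).resolve_left (ENNReal.inv_ne_zero.2 (measure_ne_top μ₁ univ))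
    obtain ⟨x, hx, y, hy, hxy⟩ := hnt
    -- Two distinct maximum points exclude dimension zero, where Lebesgue measure would charge
    -- points.
    have : Nontrivial (EuclideanSpace ℝ (Fin n)) := ⟨x, y, hxy⟩
    obtain ⟨α, g, hα, -, -, hgx⟩ := hsol x hx
    obtain ⟨β, f, -, -, -, hfy⟩ := hsol y hy
    have hac : ∀ (b : Set (EuclideanSpace ℝ (Fin n))) (p : EuclideanSpace ℝ (Fin n) → ENNReal),
        (volume.restrict b).withDensity p ≪ volume := fun b p =>
      (withDensity_absolutelyContinuous _ _).trans Measure.absolutelyContinuous_restrict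
    have h1 : NonlocalOperator.diracPlusDensity a Ω β y f {x} = 0 := by
      rw [NonlocalOperator.diracPlusDensity, Measure.add_apply, Measure.smul_apply,
        hac _ _ (measure_singleton x), Measure.dirac_apply' _ (measurableSet_singleton x),
        indicator_of_notMem (fun h => hxy (mem_singleton_iff.1 h).symm), smul_zero, add_zero]
    have h2 := huniq _ _ hgx hfy h1
    have hα0 : ENNReal.ofReal α = 0 := by
      rw [NonlocalOperator.diracPlusDensity, Measure.add_apply, Measure.smul_apply,
        Measure.dirac_apply_of_mem (mem_singleton x), smul_eq_mul, mul_one, add_eq_zero] at h2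
      exact h2.1
    refine hsing ((huniq _ _ hμ hgx).trans ?_)
    rw [NonlocalOperator.diracPlusDensity, hα0, zero_smul, zero_add]
    exact hac _ _
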